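/- Lemma 3.1 (connection 1-forms, even dimensions). Let $(M,g)$ be a smooth Riemannian manifold of even dimension $D=2n$, $T$ a smooth 3-form on $M$, $\nabla$ the Levi-Civita connection, and $$\nabla^T_XY=\nabla_XY+\tfrac12\sum_a T(X,Y,e_a)\,e_a$$ (for any orthonormal frame $(e_a)$), extended to forms as a derivation. For a 2-form $h$ put $d^Th=\sum_a e^a\wedge\nabla^T_{e_a}h$ and $\delta^Th=-\sum_a e_a\lrcorner\nabla^T_{e_a}h$. Let $h$ be a smooth 2-form which is a $d^T$-closed generalized conformal Killing–Yano tensor, i.e. $\nabla^T_Xh=\frac13X\lrcorner d^Th-\frac1{D-1}X^\flat\wedge\delta^Th$ for all $X$, and $d^Th=0$; thus $\nabla^T_Xh=X^\flat\wedge\xi$ with the associated 1-form $\xi=-\frac1{D-1}\delta^Th$. Let $U\subseteq M$ be open and let $\{e_\mu,e_{\hat\mu}\}_{\mu=1}^n$ be a canonical frame on $U$: a smooth orthonormal frame with dual coframe $\{e^\mu,e^{\hat\mu}\}$ such that on $U$ $$h=\sum_\mu x_\mu\,e^\mu\wedge e^{\hat\mu},\qquad \xi=\sum_\mu\sqrt{Q_\mu}\,e^{\hat\mu},$$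 with functions $x_\mu$ and smooth functions $Q_\mu\ge0$. Assume that $h$ is non-degenerate on $U$: it has maximal rank $2n$ at every point of $U$, and the eigenvalues $x_1,\dots,x_n$ are functionally independent ($dx_1,\dots,dx_n$ are linearly independent at every point of $U$). Let $\omega^{T\,a}{}_b(X)=e^a(\nabla^T_Xe_b)$ be the connection 1-forms and $\kappa_a{}^b=e^b(\nabla^T_{e_a}\xi)$, where $\xi$ is identified with its dual vector field. Then on $U$ one has $Q_\mu>0$, $x_\mu^2\ne x_\nu^2$ for $\mu\neq\nu$, $\omega^{T\,a}{}_b=-\omega^{T\,b}{}_a$ for all $a,b$, and $$\omega^{T\,\mu}{}_\nu=-\frac{x_\nu\sqrt{Q_\nu}}{x_\mu^2-x_\nu^2}\,e^\mu-\frac{x_\mu\sqrt{Q_\mu}}{x_\mu^2-x_\nu^2}\,e^\nu\quad(\mu\ne\nu),$$ $$\omega^{T\,\mu}{}_{\hat\mu}=-\frac1{\sqrt{Q_\mu}}\sum_{\nu\ne\mu}\frac{x_\mu Q_\nu}{x_\mu^2-x_\nu^2}\,e^{\hat\mu}+\sum_{\nu\ne\mu}\frac{x_\mu\sqrt{Q_\nu}}{x_\mu^2-x_\nu^2}\,e^{\hat\nu}+\sum_a\frac{\kappa_a{}^\mu}{\sqrt{Q_\mu}}\,e^a,$$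 $$\omega^{T\,\mu}{}_{\hat\nu}=\frac{x_\mu\sqrt{Q_\nu}}{x_\mu^2-x_\nu^2}\,e^{\hat\mu}-\frac{x_\mu\sqrt{Q_\mu}}{x_\mu^2-x_\nu^2}\,e^{\hat\nu}\quad(\mu\ne\nu),$$ $$\omega^{T\,\hat\mu}{}_{\hat\nu}=-\frac{x_\mu\sqrt{Q_\nu}}{x_\mu^2-x_\nu^2}\,e^\mu-\frac{x_\nu\sqrt{Q_\mu}}{x_\mu^2-x_\nu^2}\,e^\nu\quad(\mu\ne\nu),$$ where $a$ in $\sum_a$ runs over all $2n$ frame indices $\mu,\hat\mu$. -/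

import Mathlib

open Bundle
open scoped Manifold ContDiff

noncomputable section

section Forms

variable {E : Type*} [NormedAddCommGroup E] [NormedSpace ℝ E]
  {H : Type*} [TopologicalSpace H] (I : ModelWithCorners ℝ E H)
  (M : Type*) [TopologicalSpace M] [ChartedSpace H M] [IsManifold I ∞ M]

/-- Smooth differential 2-forms on `M`: smooth sections of `Hom(TM, Hom(TM, ℝ))` that are
alternating. -/
structure SmoothTwoForm where
  toFun : (p : M) → TangentSpace I p →L[ℝ] TangentSpace I p →L[ℝ] ℝ
  alternating : ∀ (p : M) (v : TangentSpace I p), toFun p v v = 0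
  smooth : ContMDiff I (I.prod 𝓘(ℝ, E →L[ℝ] E →L[ℝ] ℝ)) ∞
    (fun p : M ↦ TotalSpace.mk' (E →L[ℝ] E →L[ℝ] ℝ)
      (E := fun p : M ↦ TangentSpace I p →L[ℝ] TangentSpace I p →L[ℝ] ℝ) p (toFun p))

set_option maxSynthPendingDepth 3 in
/-- Smooth differential 3-forms on `M`: smooth sections of `Hom(TM, Hom(TM, Hom(TM, ℝ)))` that are
alternating. -/
structure SmoothThreeForm where
  toFun : (p : M) → TangentSpace I p →L[ℝ] TangentSpace I p →L[ℝ] TangentSpace I p →L[ℝ] ℝ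
  alternating_left : ∀ (p : M) (v w : TangentSpace I p), toFun p v v w = 0
  alternating_right : ∀ (p : M) (v w : TangentSpace I p), toFun p v w w = 0
  smooth : ContMDiff I (I.prod 𝓘(ℝ, E →L[ℝ] E →L[ℝ] E →L[ℝ] ℝ)) ∞
    (fun p : M ↦ TotalSpace.mk' (E →L[ℝ] E →L[ℝ] E →L[ℝ] ℝ)
      (E := fun p : M ↦
        TangentSpace I p →L[ℝ] TangentSpace I p →L[ℝ] TangentSpace I p →L[ℝ] ℝ) p (toFun p))

end Forms

section CovariantDerivativeOfForm

variable {E : Type*} [NormedAddCommGroup E] [NormedSpace ℝ E]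
  {H : Type*} [TopologicalSpace H] {I : ModelWithCorners ℝ E H}
  {M : Type*} [TopologicalSpace M] [ChartedSpace H M] [IsManifold I ∞ M]

lemma SmoothTwoForm.mdifferentiableAt_apply (h : SmoothTwoForm I M)
    {Y Z : (p : M) → TangentSpace I p} {p : M}
    (hY : MDiffAt (T% Y) p) (hZ : MDiffAt (T% Z) p) :
    MDiffAt (fun q ↦ h.toFun q (Y q) (Z q)) p := by
  have hh := (h.smooth p).mdifferentiableAt (by simp)
  have : MDifferentiableAt I (I.prod 𝓘(ℝ, ℝ))
      (fun m ↦ TotalSpace.mk' ℝ (E := Bundle.Trivial M ℝ) m (h.toFun m (Y m) (Z m))) p := by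
    apply MDifferentiableAt.clm_bundle_apply₂ (F₁ := E) (F₂ := E) (b := id)
    · exact hh
    · exact hY
    · exact hZ
  simp only [mdifferentiableAt_totalSpace] at this
  exact this.2

variable (D : CovariantDerivative I E (TangentSpace I : M → Type _)) (h : SmoothTwoForm I M)

/-- `v(h(Y,Z)) - h(D_v Y, Z) - h(Y, D_v Z)` for a tangent vector `v` at `p` and vector fields
`Y`, `Z`. -/
def covDerivTwoFormAux (p : M) (v : TangentSpace I p) (Y Z : (p : M) → TangentSpace I p) : ℝ :=
  mvfderiv I (fun q ↦ h.toFun q (Y q) (Z q)) p v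
    - h.toFun p (D Y p v) (Z p) - h.toFun p (Y p) (D Z p v)

lemma covDerivTwoFormAux_tensorial_left (p : M) (v : TangentSpace I p)
    (Z : (p : M) → TangentSpace I p) (hZ : MDiffAt (T% Z) p) :
    TensorialAt I E (fun Y ↦ covDerivTwoFormAux D h p v Y Z) p where
  smul {f Y} hf hY := by
    have := mvfderiv_fun_mul hf (h.mdifferentiableAt_apply hY hZ)
    simp [covDerivTwoFormAux, this, D.isCovariantDerivativeOn.leibniz hY hf]
    ring
  add {Y Y'} hY hY' := by
    have := mvfderiv_fun_add (h.mdifferentiableAt_apply hY hZ) (h.mdifferentiableAt_apply hY' hZ)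
    simp [covDerivTwoFormAux, this, D.isCovariantDerivativeOn.add hY hY']
    ring

lemma covDerivTwoFormAux_tensorial_right (p : M) (v : TangentSpace I p)
    (Y : (p : M) → TangentSpace I p) (hY : MDiffAt (T% Y) p) :
    TensorialAt I E (fun Z ↦ covDerivTwoFormAux D h p v Y Z) p where
  smul {f Z} hf hZ := by
    have := mvfderiv_fun_mul hf (h.mdifferentiableAt_apply hY hZ)
    simp [covDerivTwoFormAux, this, D.isCovariantDerivativeOn.leibniz hZ hf]
    ring
  add {Z Z'} hZ hZ' := by
    have := mvfderiv_fun_add (h.mdifferentiableAt_apply hY hZ) (h.mdifferentiableAt_apply hY hZ')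
    simp [covDerivTwoFormAux, this, D.isCovariantDerivativeOn.add hZ hZ']
    ring

variable [FiniteDimensional ℝ E]

/-- The covariant derivative of a 2-form: `covDerivTwoForm D h p v y z = (D_v h)(y, z)`. It is the
tensor with `(D_X h)(Y,Z) = X(h(Y,Z)) - h(D_X Y, Z) - h(Y, D_X Z)` for vector fields `X`, `Y`,
`Z`, see `covDerivTwoForm_apply`. -/
def covDerivTwoForm (p : M) (v y z : TangentSpace I p) : ℝ :=
  TensorialAt.mkHom₂ (covDerivTwoFormAux D h p v) p
    (fun Z hZ ↦ covDerivTwoFormAux_tensorial_left D h p v Z hZ)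
    (fun Y hY ↦ covDerivTwoFormAux_tensorial_right D h p v Y hY) y z

lemma covDerivTwoForm_apply {Y Z : (p : M) → TangentSpace I p} {p : M}
    (hY : MDiffAt (T% Y) p) (hZ : MDiffAt (T% Z) p) (v : TangentSpace I p) :
    covDerivTwoForm D h p v (Y p) (Z p) =
      mvfderiv I (fun q ↦ h.toFun q (Y q) (Z q)) p v
        - h.toFun p (D Y p v) (Z p) - h.toFun p (Y p) (D Z p v) := by
  unfold covDerivTwoForm
  exact TensorialAt.mkHom₂_apply _ _ hY hZ

end CovariantDerivativeOfForm

section Torsion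

variable {E : Type*} [NormedAddCommGroup E] [NormedSpace ℝ E] [FiniteDimensional ℝ E]
  {H : Type*} [TopologicalSpace H] {I : ModelWithCorners ℝ E H}
  {M : Type*} [TopologicalSpace M] [ChartedSpace H M] [IsManifold I ∞ M]
  [RiemannianBundle (TangentSpace I : M → Type _)]

instance tangentSpace_finiteDimensional (p : M) : FiniteDimensional ℝ (TangentSpace I p) :=
  inferInstanceAs (FiniteDimensional ℝ E)

/-- An orthonormal basis of the tangent space at `p`. -/
abbrev tangentONB (p : M) :
    OrthonormalBasis (Fin (Module.finrank ℝ (TangentSpace I p))) ℝ (TangentSpace I p) :=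
  stdOrthonormalBasis ℝ (TangentSpace I p)

set_option synthInstance.maxHeartbeats 100000 in
/-- `Y ↦ (X ↦ ½ ∑ₐ T(X, Y, eₐ) eₐ)`, for an orthonormal basis `(eₐ)` of the tangent space. -/
def torsionTerm (T : SmoothThreeForm I M) (p : M) :
    TangentSpace I p →L[ℝ] TangentSpace I p →L[ℝ] TangentSpace I p :=
  (LinearMap.mk₂ ℝ
    (fun y v : TangentSpace I p ↦
      (1 / 2 : ℝ) • ∑ a, T.toFun p v y (tangentONB p a) • tangentONB p a)
    (fun y y' v ↦ by simp [Finset.sum_add_distrib, add_smul])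
    (fun c y v ↦ by simp [Finset.smul_sum, mul_smul, smul_comm c])
    (fun y v v' ↦ by
      simp [ContinuousLinearMap.map_add, Finset.sum_add_distrib, add_smul])
    (fun c y v ↦ by
      simp [Finset.smul_sum, mul_smul, smul_comm c])).toContinuousBilinearMap

lemma torsionTerm_apply (T : SmoothThreeForm I M) (p : M) (y v : TangentSpace I p) :
    torsionTerm T p y v =
      (1 / 2 : ℝ) • ∑ a, T.toFun p v y (tangentONB p a) • tangentONB p a := by
  rfl

/-- The connection with torsion, `∇ᵀ_X Y = ∇_X Y + ½ ∑ₐ T(X, Y, eₐ) eₐ`. -/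
def connectionWithTorsion (nabla : CovariantDerivative I E (TangentSpace I : M → Type _))
    (T : SmoothThreeForm I M) : CovariantDerivative I E (TangentSpace I : M → Type _) :=
  nabla.addOneForm (torsionTerm T)

lemma connectionWithTorsion_apply
    (nabla : CovariantDerivative I E (TangentSpace I : M → Type _))
    (T : SmoothThreeForm I M) (Y : (p : M) → TangentSpace I p) (p : M) (v : TangentSpace I p) :
    connectionWithTorsion nabla T Y p v = nabla Y p v +
      (1 / 2 : ℝ) • ∑ a, T.toFun p v (Y p) (tangentONB p a) • tangentONB p a := by
  rw [← torsionTerm_apply]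
  rfl

/-- `nabla` is the Levi-Civita connection of the Riemannian metric: the metric and torsion-free
connection on the tangent bundle. -/
def IsLeviCivita [IsContMDiffRiemannianBundle I ∞ E (TangentSpace I : M → Type _)]
    (nabla : CovariantDerivative I E (TangentSpace I : M → Type _)) : Prop :=
  CovariantDerivative.IsMetricCompatible (V := (TangentSpace I : M → Type _)) nabla ∧
    nabla.torsion = 0

end Torsion

section KillingYano

variable {E : Type*} [NormedAddCommGroup E] [NormedSpace ℝ E] [FiniteDimensional ℝ E]
  {H : Type*} [TopologicalSpace H] {I : ModelWithCorners ℝ E H}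
  {M : Type*} [TopologicalSpace M] [ChartedSpace H M] [IsManifold I ∞ M]
  [RiemannianBundle (TangentSpace I : M → Type _)]

/-- `dᵀh = ∑ₐ eᵃ ∧ ∇ᵀ_{eₐ} h` for a 2-form `h` and `D = ∇ᵀ`; evaluated on three vectors this is the
cyclic sum of `∇ᵀh`. -/
def exteriorDerivTwoForm (D : CovariantDerivative I E (TangentSpace I : M → Type _))
    (h : SmoothTwoForm I M) (p : M) (u v w : TangentSpace I p) : ℝ :=
  covDerivTwoForm D h p u v w + covDerivTwoForm D h p v w u + covDerivTwoForm D h p w u v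

/-- `δᵀh = -∑ₐ eₐ ⌟ ∇ᵀ_{eₐ} h` for a 2-form `h` and `D = ∇ᵀ`. -/
def coderivTwoForm (D : CovariantDerivative I E (TangentSpace I : M → Type _))
    (h : SmoothTwoForm I M) (p : M) (v : TangentSpace I p) : ℝ :=
  -∑ a, covDerivTwoForm D h p (tangentONB p a) (tangentONB p a) v

/-- The generalized conformal Killing-Yano equation for 2-forms, with respect to `D = ∇ᵀ`:
`∇ᵀ_X h = (1/3) X ⌟ dᵀh - (1/(dim M - 1)) X♭ ∧ δᵀh`. -/
def IsGCKY (D : CovariantDerivative I E (TangentSpace I : M → Type _))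
    (h : SmoothTwoForm I M) : Prop :=
  ∀ (p : M) (v y z : TangentSpace I p),
    covDerivTwoForm D h p v y z =
      (1 / 3 : ℝ) * exteriorDerivTwoForm D h p v y z
        - 1 / ((Module.finrank ℝ E : ℝ) - 1) *
          (inner ℝ v y * coderivTwoForm D h p z - inner ℝ v z * coderivTwoForm D h p y)

/-- `dᵀ`-closed generalized conformal Killing-Yano 2-forms. -/
def IsClosedGCKY (D : CovariantDerivative I E (TangentSpace I : M → Type _))
    (h : SmoothTwoForm I M) : Prop :=
  IsGCKY D h ∧ ∀ (p : M) (u v w : TangentSpace I p), exteriorDerivTwoForm D h p u v w = 0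

/-- The associated 1-form `ξ = -(1/(dim M - 1)) δᵀh`. -/
def associatedOneForm (D : CovariantDerivative I E (TangentSpace I : M → Type _))
    (h : SmoothTwoForm I M) (p : M) (v : TangentSpace I p) : ℝ :=
  -(1 / ((Module.finrank ℝ E : ℝ) - 1)) * coderivTwoForm D h p v

/-- The vector field dual to the associated 1-form. -/
def associatedVector (D : CovariantDerivative I E (TangentSpace I : M → Type _))
    (h : SmoothTwoForm I M) (p : M) : TangentSpace I p :=
  ∑ a, associatedOneForm D h p (tangentONB p a) • tangentONB p a

/-- The smooth frame `e` on `U`, with `e (Sum.inl μ) = e_μ` and `e (Sum.inr μ) = e_μ̂`, is a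
canonical frame for `h`, with eigenvalues `x μ` and functions `Q μ`: it is orthonormal,
`h = ∑ x_μ e^μ ∧ e^μ̂` and `ξ = ∑ √Q_μ e^μ̂`. -/
structure IsCanonicalFrameOn (D : CovariantDerivative I E (TangentSpace I : M → Type _))
    (h : SmoothTwoForm I M) (U : Set M) {n : ℕ}
    (e : Fin n ⊕ Fin n → (p : M) → TangentSpace I p) (x Q : Fin n → M → ℝ) : Prop where
  isLocalFrame : IsLocalFrameOn I E ∞ e U
  orthonormal : ∀ p ∈ U, Orthonormal ℝ (fun a ↦ e a p)
  twoForm_eq : ∀ p ∈ U, ∀ v w : TangentSpace I p, h.toFun p v w =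
    ∑ μ, x μ p * (inner ℝ (e (.inl μ) p) v * inner ℝ (e (.inr μ) p) w
      - inner ℝ (e (.inl μ) p) w * inner ℝ (e (.inr μ) p) v)
  Q_smooth : ∀ μ, ContMDiffOn I 𝓘(ℝ, ℝ) ∞ (Q μ) U
  Q_nonneg : ∀ μ, ∀ p ∈ U, 0 ≤ Q μ p
  associatedOneForm_eq : ∀ p ∈ U, ∀ v : TangentSpace I p, associatedOneForm D h p v =
    ∑ μ, √(Q μ p) * inner ℝ (e (.inr μ) p) v

/-- Non-degeneracy of a 2-form with eigenvalues `x μ` on `U`, in even dimensions: its rank is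
maximal at all points and its eigenvalues are functionally independent. -/
structure IsNondegenerateOn (h : SmoothTwoForm I M) (U : Set M) {n : ℕ} (x : Fin n → M → ℝ) :
    Prop where
  rank_maximal : ∀ p ∈ U, ∀ v : TangentSpace I p,
    (∀ w : TangentSpace I p, h.toFun p v w = 0) → v = 0
  independent : ∀ p ∈ U, LinearIndependent ℝ (fun μ ↦ mvfderiv I (x μ) p)

/-- The connection 1-form `ω^c_b(v) = e^c(D_v e_b)` in an orthonormal frame. -/
def connectionForm (D : CovariantDerivative I E (TangentSpace I : M → Type _)) {ι : Type*}
    (e : ι → (p : M) → TangentSpace I p) (c b : ι) (p : M) (v : TangentSpace I p) : ℝ :=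
  inner ℝ (e c p) (D (e b) p v)

/-- `κ_a^b = e^b(D_{e_a} ξ)` in an orthonormal frame, where `ξ` is the associated vector field. -/
def kappa (D : CovariantDerivative I E (TangentSpace I : M → Type _)) (h : SmoothTwoForm I M)
    {ι : Type*} (e : ι → (p : M) → TangentSpace I p) (a b : ι) (p : M) : ℝ :=
  inner ℝ (e b p) (D (associatedVector D h) p (e a p))

end KillingYano
end

section Calculus

variable {E : Type*} [NormedAddCommGroup E] [NormedSpace ℝ E]
  {H : Type*} [TopologicalSpace H] {I : ModelWithCorners ℝ E H}
  {M : Type*} [TopologicalSpace M] [ChartedSpace H M]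

lemma Filter.EventuallyEq.mvfderiv_eq {f g : M → ℝ} {p : M} (hfg : f =ᶠ[nhds p] g) :
    mvfderiv I f p = mvfderiv I g p := by
  ext v
  exact congrArg (fun L ↦ L v) (hfg.mfderiv_eq (I := I) (I' := 𝓘(ℝ, ℝ)))

lemma mvfderiv_eq_zero_of_eventuallyEq_const {f : M → ℝ} {p : M} {c : ℝ}
    (hf : ∀ᶠ q in nhds p, f q = c) : mvfderiv I f p = 0 := by
  have hfc : f =ᶠ[nhds p] fun _ ↦ c := hf
  rw [hfc.mvfderiv_eq]
  exact mvfderiv_const c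

variable [IsManifold I ∞ M]

lemma SmoothTwoForm.apply_swap (h : SmoothTwoForm I M) (p : M) (v w : TangentSpace I p) :
    h.toFun p v w = -h.toFun p w v := by
  have := h.alternating p (v + w)
  simp [h.alternating] at this
  linarith

lemma SmoothThreeForm.apply_swap_right (T : SmoothThreeForm I M) (p : M)
    (u v w : TangentSpace I p) : T.toFun p u v w = -T.toFun p u w v := by
  have := T.alternating_right p u (v + w)
  simp [T.alternating_right] at this
  linarith

/-- The Leibniz rule for a linear combination of vector fields. -/
lemma CovariantDerivative.sum_smul_apply
    (D : CovariantDerivative I E (TangentSpace I : M → Type _)) {ι : Type*} (s : Finset ι)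
    {f : ι → M → ℝ} {σ : ι → (p : M) → TangentSpace I p} {p : M}
    (hf : ∀ i, MDiffAt (f i) p) (hσ : ∀ i, MDiffAt (T% (σ i)) p) (v : TangentSpace I p) :
    MDiffAt (T% (fun q ↦ ∑ i ∈ s, f i q • σ i q)) p ∧
    D (fun q ↦ ∑ i ∈ s, f i q • σ i q) p v =
      ∑ i ∈ s, (f i p • D (σ i) p v + mvfderiv I (f i) p v • σ i p) := by
  classical
  induction s using Finset.induction_on with
  | empty =>
    have : (fun q ↦ ∑ i ∈ (∅ : Finset ι), f i q • σ i q) = (0 : (q : M) → TangentSpace I q) := by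
      ext q; simp
    rw [this, D.zero]
    exact ⟨mdifferentiableAt_zeroSection .., by simp⟩
  | insert j s hj ih =>
    have hj' : MDiffAt (T% (f j • σ j)) p := (hf j).smul_section (hσ j)
    have : (fun q ↦ ∑ i ∈ insert j s, f i q • σ i q) =
        f j • σ j + fun q ↦ ∑ i ∈ s, f i q • σ i q := by
      ext q; simp [Finset.sum_insert hj]
    have hd := mdifferentiableAt_add_section hj' ih.1
    rw [← this] at hd
    refine ⟨hd, ?_⟩
    rw [this, D.isCovariantDerivativeOn.add hj' ih.1, D.isCovariantDerivativeOn.leibniz (hσ j) (hf j),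
      Finset.sum_insert hj, ← ih.2]
    simp

end Calculus

section Metric

variable {E : Type*} [NormedAddCommGroup E] [NormedSpace ℝ E] [FiniteDimensional ℝ E]
  {H : Type*} [TopologicalSpace H] {I : ModelWithCorners ℝ E H}
  {M : Type*} [TopologicalSpace M] [ChartedSpace H M] [IsManifold I ∞ M]
  [RiemannianBundle (TangentSpace I : M → Type _)]

lemma inner_torsionTerm (T : SmoothThreeForm I M) (p : M) (y v w : TangentSpace I p) :
    inner ℝ w (torsionTerm T p y v) = 1 / 2 * T.toFun p v y w := by
  rw [torsionTerm_apply, inner_smul_right, inner_sum]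
  congr 1
  nth_rw 2 [← (tangentONB p).sum_repr' w]
  rw [map_sum]
  refine Finset.sum_congr rfl fun a _ ↦ ?_
  rw [inner_smul_right, map_smul, real_inner_comm, smul_eq_mul, mul_comm]

variable [IsContMDiffRiemannianBundle I ∞ E (TangentSpace I : M → Type _)]

/-- The connection with torsion is metric. -/
lemma IsLeviCivita.mvfderiv_inner_connectionWithTorsion
    {nabla : CovariantDerivative I E (TangentSpace I : M → Type _)} (hLC : IsLeviCivita nabla)
    (T : SmoothThreeForm I M) {Y Z : (p : M) → TangentSpace I p} {p : M}
    (hY : MDiffAt (T% Y) p) (hZ : MDiffAt (T% Z) p) (v : TangentSpace I p) :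
    mvfderiv I (fun q ↦ (inner ℝ (Y q) (Z q) : ℝ)) p v =
      inner ℝ (Z p) (connectionWithTorsion nabla T Y p v) +
        inner ℝ (Y p) (connectionWithTorsion nabla T Z p v) := by
  have key := hLC.1.mvfderiv_inner_eq (FiberBundle.extend E v) hY hZ
  simp only [FiberBundle.extend_apply_self] at key
  rw [key]
  have hc (W : (p : M) → TangentSpace I p) :
      connectionWithTorsion nabla T W p v = nabla W p v + torsionTerm T p (W p) v := rfl
  rw [hc, hc, inner_add_right, inner_add_right, inner_torsionTerm, inner_torsionTerm,
    T.apply_swap_right p v (Y p), real_inner_comm (Z p)]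
  ring

lemma IsLeviCivita.connectionForm_skew
    {nabla : CovariantDerivative I E (TangentSpace I : M → Type _)} (hLC : IsLeviCivita nabla)
    (T : SmoothThreeForm I M) {ι : Type*} {e : ι → (p : M) → TangentSpace I p} {U : Set M}
    (hU : IsOpen U) {p : M} (hp : p ∈ U) (he : ∀ a, MDiffAt (T% (e a)) p)
    (ho : ∀ q ∈ U, Orthonormal ℝ (fun a ↦ e a q)) (a b : ι) (v : TangentSpace I p) :
    connectionForm (connectionWithTorsion nabla T) e a b p v =
      -connectionForm (connectionWithTorsion nabla T) e b a p v := by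
  classical
  have hconst : ∀ᶠ q in nhds p, (inner ℝ (e a q) (e b q) : ℝ) = if a = b then 1 else 0 :=
    Filter.mem_of_superset (hU.mem_nhds hp) fun q hq ↦ orthonormal_iff_ite.1 (ho q hq) a b
  have := hLC.mvfderiv_inner_connectionWithTorsion T (he a) (he b) v
  rw [mvfderiv_eq_zero_of_eventuallyEq_const hconst] at this
  simp only [connectionForm]
  simp at this
  linarith

end Metric

section ClosedGCKY

variable {E : Type*} [NormedAddCommGroup E] [NormedSpace ℝ E] [FiniteDimensional ℝ E]
  {H : Type*} [TopologicalSpace H] {I : ModelWithCorners ℝ E H}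
  {M : Type*} [TopologicalSpace M] [ChartedSpace H M] [IsManifold I ∞ M]
  [RiemannianBundle (TangentSpace I : M → Type _)]
  {D : CovariantDerivative I E (TangentSpace I : M → Type _)} {h : SmoothTwoForm I M}

/-- `∇ᵀ_X h = X♭ ∧ ξ`. -/
lemma IsClosedGCKY.covDerivTwoForm_eq (hh : IsClosedGCKY D h) (p : M) (v y z : TangentSpace I p) :
    covDerivTwoForm D h p v y z =
      inner ℝ v y * associatedOneForm D h p z - inner ℝ v z * associatedOneForm D h p y := by
  rw [hh.1, hh.2, associatedOneForm, associatedOneForm]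
  ring

namespace IsCanonicalFrameOn

variable {U : Set M} {n : ℕ} {e : Fin n ⊕ Fin n → (p : M) → TangentSpace I p} {x Q : Fin n → M → ℝ}
  {p : M}

lemma mdifferentiableAt (hf : IsCanonicalFrameOn D h U e x Q) (hU : IsOpen U) (hp : p ∈ U)
    (a : Fin n ⊕ Fin n) : MDiffAt (T% (e a)) p :=
  (hf.isLocalFrame.contMDiffAt hU hp a).mdifferentiableAt (by simp)

lemma inner_eq (hf : IsCanonicalFrameOn D h U e x Q) (hp : p ∈ U) (a b : Fin n ⊕ Fin n) :
    (inner ℝ (e a p) (e b p) : ℝ) = if a = b then 1 else 0 :=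
  orthonormal_iff_ite.1 (hf.orthonormal p hp) a b

lemma twoForm_inl (hf : IsCanonicalFrameOn D h U e x Q) (hp : p ∈ U) (μ : Fin n)
    (w : TangentSpace I p) :
    h.toFun p (e (.inl μ) p) w = x μ p * inner ℝ (e (.inr μ) p) w := by
  rw [hf.twoForm_eq p hp, Finset.sum_eq_single μ]
  · simp [hf.inner_eq hp, -inner_self_eq_norm_sq_to_K]
  · intro ν _ hν
    simp [hf.inner_eq hp, hν]
  · simp

lemma twoForm_inr (hf : IsCanonicalFrameOn D h U e x Q) (hp : p ∈ U) (μ : Fin n)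
    (w : TangentSpace I p) :
    h.toFun p (e (.inr μ) p) w = -(x μ p * inner ℝ (e (.inl μ) p) w) := by
  rw [hf.twoForm_eq p hp, Finset.sum_eq_single μ]
  · simp [hf.inner_eq hp, -inner_self_eq_norm_sq_to_K]
  · intro ν _ hν
    simp [hf.inner_eq hp, hν]
  · simp

lemma associatedOneForm_inl (hf : IsCanonicalFrameOn D h U e x Q) (hp : p ∈ U) (μ : Fin n) :
    associatedOneForm D h p (e (.inl μ) p) = 0 := by
  simp [hf.associatedOneForm_eq p hp, hf.inner_eq hp]

lemma associatedOneForm_inr (hf : IsCanonicalFrameOn D h U e x Q) (hp : p ∈ U) (μ : Fin n) :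
    associatedOneForm D h p (e (.inr μ) p) = √(Q μ p) := by
  simp [hf.associatedOneForm_eq p hp, hf.inner_eq hp]

lemma associatedVector_eq (hf : IsCanonicalFrameOn D h U e x Q) (hp : p ∈ U) :
    associatedVector D h p = ∑ μ, √(Q μ p) • e (.inr μ) p := by
  refine ext_inner_left ℝ fun w ↦ ?_
  have : (inner ℝ w (associatedVector D h p) : ℝ) = associatedOneForm D h p w := by
    rw [associatedVector, inner_sum]
    conv_rhs => rw [← (tangentONB p).sum_repr' w]
    simp only [hf.associatedOneForm_eq p hp, inner_sum, inner_smul_right, Finset.mul_sum,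
      Finset.sum_mul]
    rw [Finset.sum_comm]
    refine Finset.sum_congr rfl fun μ _ ↦ Finset.sum_congr rfl fun a _ ↦ ?_
    rw [real_inner_comm w]
    ring
  rw [this, hf.associatedOneForm_eq p hp, inner_sum]
  simp [inner_smul_right, real_inner_comm w]

/-- The `(a, b)` component of `∇ᵀ_v h = v♭ ∧ ξ`. -/
lemma mvfderiv_twoForm (hf : IsCanonicalFrameOn D h U e x Q) (hU : IsOpen U)
    (hh : IsClosedGCKY D h) (hp : p ∈ U) (a b : Fin n ⊕ Fin n) (v : TangentSpace I p) :
    mvfderiv I (fun q ↦ h.toFun q (e a q) (e b q)) p v + h.toFun p (e b p) (D (e a) p v)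
        - h.toFun p (e a p) (D (e b) p v) =
      inner ℝ (e a p) v * associatedOneForm D h p (e b p)
        - inner ℝ (e b p) v * associatedOneForm D h p (e a p) := by
  have h1 := covDerivTwoForm_apply D h (hf.mdifferentiableAt hU hp a)
    (hf.mdifferentiableAt hU hp b) v
  rw [hh.covDerivTwoForm_eq, h.apply_swap p (D (e a) p v)] at h1
  rw [real_inner_comm v, real_inner_comm v]
  linarith

/-- `dx_μ = √Q_μ e^μ`. -/
lemma mvfderiv_eigenvalue (hf : IsCanonicalFrameOn D h U e x Q) (hU : IsOpen U)
    (hh : IsClosedGCKY D h) (hp : p ∈ U)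
    (hskew : ∀ a b v, connectionForm D e a b p v = -connectionForm D e b a p v)
    (μ : Fin n) (v : TangentSpace I p) :
    mvfderiv I (x μ) p v = √(Q μ p) * inner ℝ (e (.inl μ) p) v := by
  have hx : (fun q ↦ h.toFun q (e (.inl μ) q) (e (.inr μ) q)) =ᶠ[nhds p] x μ :=
    Filter.mem_of_superset (hU.mem_nhds hp) fun q hq ↦ by
      simp [hf.twoForm_inl hq, hf.inner_eq hq, -inner_self_eq_norm_sq_to_K]
  have h1 := hf.mvfderiv_twoForm hU hh hp (.inl μ) (.inr μ) v
  have h2 := hskew (.inl μ) (.inl μ) v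
  have h3 := hskew (.inr μ) (.inr μ) v
  rw [hx.mvfderiv_eq, hf.twoForm_inl hp, hf.twoForm_inr hp, hf.associatedOneForm_inl hp,
    hf.associatedOneForm_inr hp] at h1
  simp only [connectionForm] at h2 h3
  linear_combination h1 + x μ p / 2 * h2 + x μ p / 2 * h3

lemma Q_pos (hf : IsCanonicalFrameOn D h U e x Q) (hU : IsOpen U)
    (hh : IsClosedGCKY D h) (hnondeg : IsNondegenerateOn h U x) (hp : p ∈ U)
    (hskew : ∀ a b v, connectionForm D e a b p v = -connectionForm D e b a p v)
    (μ : Fin n) : 0 < Q μ p := by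
  refine (hf.Q_nonneg μ p hp).lt_of_ne fun h0 ↦ (hnondeg.independent p hp).ne_zero μ ?_
  ext v
  simp [hf.mvfderiv_eigenvalue hU hh hp hskew, ← h0]

lemma mvfderiv_twoForm_eq_zero (hf : IsCanonicalFrameOn D h U e x Q) (hU : IsOpen U) (hp : p ∈ U)
    {a b : Fin n ⊕ Fin n} (hab : a.elim id id ≠ b.elim id id) :
    mvfderiv I (fun q ↦ h.toFun q (e a q) (e b q)) p = 0 := by
  refine mvfderiv_eq_zero_of_eventuallyEq_const (c := 0) <|
    Filter.mem_of_superset (hU.mem_nhds hp) fun q hq ↦ ?_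
  rcases a with μ | μ <;> rcases b with ν | ν <;>
    simp_all [hf.twoForm_inl hq, hf.twoForm_inr hq, hf.inner_eq hq]

/-- The `(μ, ν)` component of `∇ᵀh = X♭ ∧ ξ`. -/
lemma twoForm_inl_inl (hf : IsCanonicalFrameOn D h U e x Q) (hU : IsOpen U)
    (hh : IsClosedGCKY D h) (hp : p ∈ U) {μ ν : Fin n} (hμν : μ ≠ ν) (v : TangentSpace I p) :
    x ν p * connectionForm D e (.inr ν) (.inl μ) p v
      - x μ p * connectionForm D e (.inr μ) (.inl ν) p v = 0 := by
  have h1 := hf.mvfderiv_twoForm hU hh hp (.inl μ) (.inl ν) v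
  rw [hf.mvfderiv_twoForm_eq_zero hU hp (by simpa), hf.twoForm_inl hp, hf.twoForm_inl hp,
    hf.associatedOneForm_inl hp, hf.associatedOneForm_inl hp] at h1
  simpa [connectionForm] using h1

/-- The `(μ̂, ν̂)` component of `∇ᵀh = X♭ ∧ ξ`. -/
lemma twoForm_inr_inr (hf : IsCanonicalFrameOn D h U e x Q) (hU : IsOpen U)
    (hh : IsClosedGCKY D h) (hp : p ∈ U) {μ ν : Fin n} (hμν : μ ≠ ν) (v : TangentSpace I p) :
    x μ p * connectionForm D e (.inl μ) (.inr ν) p v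
        - x ν p * connectionForm D e (.inl ν) (.inr μ) p v =
      √(Q ν p) * inner ℝ (e (.inr μ) p) v - √(Q μ p) * inner ℝ (e (.inr ν) p) v := by
  have h1 := hf.mvfderiv_twoForm hU hh hp (.inr μ) (.inr ν) v
  rw [hf.mvfderiv_twoForm_eq_zero hU hp (by simpa), hf.twoForm_inr hp, hf.twoForm_inr hp,
    hf.associatedOneForm_inr hp, hf.associatedOneForm_inr hp] at h1
  simp only [zero_apply] at h1
  simp only [connectionForm]
  linear_combination h1

/-- The `(μ, ν̂)` component of `∇ᵀh = X♭ ∧ ξ`. -/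
lemma twoForm_inl_inr (hf : IsCanonicalFrameOn D h U e x Q) (hU : IsOpen U)
    (hh : IsClosedGCKY D h) (hp : p ∈ U) {μ ν : Fin n} (hμν : μ ≠ ν) (v : TangentSpace I p) :
    -(x ν p * connectionForm D e (.inl ν) (.inl μ) p v)
        - x μ p * connectionForm D e (.inr μ) (.inr ν) p v =
      √(Q ν p) * inner ℝ (e (.inl μ) p) v := by
  have h1 := hf.mvfderiv_twoForm hU hh hp (.inl μ) (.inr ν) v
  rw [hf.mvfderiv_twoForm_eq_zero hU hp (by simpa), hf.twoForm_inl hp, hf.twoForm_inr hp,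
    hf.associatedOneForm_inr hp, hf.associatedOneForm_inl hp] at h1
  simp only [zero_apply] at h1
  simp only [connectionForm]
  linear_combination h1

lemma sq_sub_sq_mul_connectionForm_inl_inr (hf : IsCanonicalFrameOn D h U e x Q) (hU : IsOpen U)
    (hh : IsClosedGCKY D h) (hp : p ∈ U)
    (hskew : ∀ a b v, connectionForm D e a b p v = -connectionForm D e b a p v)
    {μ ν : Fin n} (hμν : μ ≠ ν) (v : TangentSpace I p) :
    (x μ p ^ 2 - x ν p ^ 2) * connectionForm D e (.inl μ) (.inr ν) p v =
      x μ p * (√(Q ν p) * inner ℝ (e (.inr μ) p) v - √(Q μ p) * inner ℝ (e (.inr ν) p) v) := by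
  have h1 := hf.twoForm_inl_inl hU hh hp hμν v
  rw [hskew (.inr ν), hskew (.inr μ)] at h1
  linear_combination x ν p * h1 + x μ p * hf.twoForm_inr_inr hU hh hp hμν v

/-- The squares of the eigenvalues are pairwise distinct. -/
lemma sq_ne_sq (hf : IsCanonicalFrameOn D h U e x Q) (hU : IsOpen U)
    (hh : IsClosedGCKY D h) (hnondeg : IsNondegenerateOn h U x) (hp : p ∈ U)
    (hskew : ∀ a b v, connectionForm D e a b p v = -connectionForm D e b a p v)
    {μ ν : Fin n} (hμν : μ ≠ ν) : x μ p ^ 2 ≠ x ν p ^ 2 := by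
  intro heq
  have hx : x μ p ≠ 0 := by
    intro h0
    refine (hf.orthonormal p hp).ne_zero (.inl μ) (hnondeg.rank_maximal p hp _ fun w ↦ ?_)
    rw [hf.twoForm_inl hp, h0, zero_mul]
  have h1 := hf.sq_sub_sq_mul_connectionForm_inl_inr hU hh hp hskew hμν (e (.inr μ) p)
  simp [heq, hf.inner_eq hp, hμν.symm, hx, -inner_self_eq_norm_sq_to_K] at h1
  exact (Real.sqrt_pos.2 (hf.Q_pos hU hh hnondeg hp hskew ν)).ne' h1

/-- `∑ₐ κ_a^μ e^a = ∑_ν √Q_ν ω^μ_ν̂`. -/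
lemma sum_kappa_inl (hf : IsCanonicalFrameOn D h U e x Q) (hU : IsOpen U) (hp : p ∈ U)
    (hQ : ∀ μ, 0 < Q μ p) (μ : Fin n) (v : TangentSpace I p) :
    ∑ a, kappa D h e a (.inl μ) p * inner ℝ (e a p) v =
      ∑ ν, √(Q ν p) * connectionForm D e (.inl μ) (.inr ν) p v := by
  have hsqrt (ν : Fin n) : MDiffAt (fun q ↦ √(Q ν q)) p := by
    have h1 : MDiffAt (Q ν) p :=
      ((hf.Q_smooth ν).contMDiffAt (hU.mem_nhds hp)).mdifferentiableAt (by simp)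
    have h2 : MDifferentiableAt 𝓘(ℝ, ℝ) 𝓘(ℝ, ℝ) Real.sqrt (Q ν p) :=
      (Real.hasDerivAt_sqrt (hQ ν).ne').differentiableAt.mdifferentiableAt
    exact h2.comp p h1
  have hsum (w : TangentSpace I p) := D.sum_smul_apply Finset.univ hsqrt
    (fun ν ↦ hf.mdifferentiableAt hU hp (.inr ν)) w
  have heq : ∀ᶠ q in nhds p, associatedVector D h q = ∑ ν, √(Q ν q) • e (.inr ν) q :=
    Filter.mem_of_superset (hU.mem_nhds hp) fun q hq ↦ hf.associatedVector_eq hq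
  have hdiff : MDiffAt (T% (associatedVector D h)) p :=
    (hsum v).1.congr_of_eventuallyEq (heq.mono fun q hq ↦ by simp only [hq])
  have hD := D.isCovariantDerivativeOn.congr_of_eventuallyEq hdiff (hsum v).1
    Filter.univ_mem heq
  let B : OrthonormalBasis (Fin n ⊕ Fin n) ℝ (TangentSpace I p) :=
    OrthonormalBasis.mk (hf.orthonormal p hp) (hf.isLocalFrame.generating hp)
  have hv : ∑ a, (inner ℝ (e a p) v : ℝ) • e a p = v := by
    have := B.sum_repr' v
    simpa [B] using this
  calc ∑ a, kappa D h e a (.inl μ) p * inner ℝ (e a p) v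
      = inner ℝ (e (.inl μ) p) (D (associatedVector D h) p v) := by
        conv_rhs => rw [← hv, map_sum, inner_sum]
        refine Finset.sum_congr rfl fun a _ ↦ ?_
        rw [map_smul, inner_smul_right, kappa, mul_comm]
    _ = _ := by
        rw [hD, (hsum v).2, inner_sum]
        refine Finset.sum_congr rfl fun ν _ ↦ ?_
        simp [inner_add_right, inner_smul_right, hf.inner_eq hp, connectionForm]

end IsCanonicalFrameOn

end ClosedGCKY

theorem lemma3p1
    {E : Type*} [NormedAddCommGroup E] [NormedSpace ℝ E] [FiniteDimensional ℝ E]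
    {H : Type*} [TopologicalSpace H] {I : ModelWithCorners ℝ E H}
    {M : Type*} [TopologicalSpace M] [ChartedSpace H M] [IsManifold I ∞ M]
    [RiemannianBundle (TangentSpace I : M → Type _)]
    [IsContMDiffRiemannianBundle I ∞ E (TangentSpace I : M → Type _)]
    (n : ℕ) (hdim : Module.finrank ℝ E = 2 * n)
    (nabla : CovariantDerivative I E (TangentSpace I : M → Type _)) (hLC : IsLeviCivita nabla)
    (T : SmoothThreeForm I M) (h : SmoothTwoForm I M)
    (hCKY : IsClosedGCKY (connectionWithTorsion nabla T) h)
    (U : Set M) (hU : IsOpen U)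
    (e : Fin n ⊕ Fin n → (p : M) → TangentSpace I p) (x Q : Fin n → M → ℝ)
    (hframe : IsCanonicalFrameOn (connectionWithTorsion nabla T) h U e x Q)
    (hnondeg : IsNondegenerateOn h U x)
    (p : M) (hp : p ∈ U) :
    let conn := fun (c b : Fin n ⊕ Fin n) (v : TangentSpace I p) ↦
      connectionForm (connectionWithTorsion nabla T) e c b p v
    let κ := fun a b : Fin n ⊕ Fin n ↦ kappa (connectionWithTorsion nabla T) h e a b p
    let θ := fun (a : Fin n ⊕ Fin n) (v : TangentSpace I p) ↦ (inner ℝ (e a p) v : ℝ)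
    -- all denominators below are nonzero
    (∀ μ, 0 < Q μ p) ∧
    (∀ μ ν, μ ≠ ν → x μ p ^ 2 ≠ x ν p ^ 2) ∧
    -- skew-symmetry determines the remaining connection 1-forms
    (∀ a b, ∀ v, conn a b v = -conn b a v) ∧
    (∀ μ ν, μ ≠ ν → ∀ v, conn (.inl μ) (.inl ν) v =
      -(x ν p * √(Q ν p) / (x μ p ^ 2 - x ν p ^ 2)) * θ (.inl μ) v
        - x μ p * √(Q μ p) / (x μ p ^ 2 - x ν p ^ 2) * θ (.inl ν) v) ∧
    (∀ μ, ∀ v, conn (.inl μ) (.inr μ) v =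
      -(1 / √(Q μ p)) *
          (∑ ν ∈ Finset.univ.erase μ, x μ p * Q ν p / (x μ p ^ 2 - x ν p ^ 2)) * θ (.inr μ) v
        + ∑ ν ∈ Finset.univ.erase μ,
            x μ p * √(Q ν p) / (x μ p ^ 2 - x ν p ^ 2) * θ (.inr ν) v
        + ∑ a, κ a (.inl μ) / √(Q μ p) * θ a v) ∧
    (∀ μ ν, μ ≠ ν → ∀ v, conn (.inl μ) (.inr ν) v =
      x μ p * √(Q ν p) / (x μ p ^ 2 - x ν p ^ 2) * θ (.inr μ) v
        - x μ p * √(Q μ p) / (x μ p ^ 2 - x ν p ^ 2) * θ (.inr ν) v) ∧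
    (∀ μ ν, μ ≠ ν → ∀ v, conn (.inr μ) (.inr ν) v =
      -(x μ p * √(Q ν p) / (x μ p ^ 2 - x ν p ^ 2)) * θ (.inl μ) v
        - x ν p * √(Q μ p) / (x μ p ^ 2 - x ν p ^ 2) * θ (.inl ν) v) := by
  intro conn κ θ
  have hskew : ∀ a b v, connectionForm (connectionWithTorsion nabla T) e a b p v =
      -connectionForm (connectionWithTorsion nabla T) e b a p v :=
    hLC.connectionForm_skew T hU hp (hframe.mdifferentiableAt hU hp) hframe.orthonormal
  have hQ := hframe.Q_pos hU hCKY hnondeg hp hskew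
  have hx : ∀ μ ν, μ ≠ ν → x μ p ^ 2 - x ν p ^ 2 ≠ 0 := fun μ ν hμν ↦
    sub_ne_zero.2 (hframe.sq_ne_sq hU hCKY hnondeg hp hskew hμν)
  have hmixed : ∀ μ ν, μ ≠ ν → ∀ v, conn (.inl μ) (.inr ν) v =
      x μ p * √(Q ν p) / (x μ p ^ 2 - x ν p ^ 2) * θ (.inr μ) v
        - x μ p * √(Q μ p) / (x μ p ^ 2 - x ν p ^ 2) * θ (.inr ν) v := by
    intro μ ν hμν v
    have h1 := hframe.sq_sub_sq_mul_connectionForm_inl_inr hU hCKY hp hskew hμν v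
    have h0 := hx μ ν hμν
    simp only [conn, θ]
    field_simp
    linear_combination h1
  refine ⟨hQ, fun μ ν hμν ↦ sub_ne_zero.1 (hx μ ν hμν), hskew, ?_, ?_, hmixed, ?_⟩
  · intro μ ν hμν v
    have h1 := hframe.twoForm_inl_inr hU hCKY hp hμν v
    have h2 := hframe.twoForm_inl_inr hU hCKY hp hμν.symm v
    rw [hskew (.inl ν)] at h1
    rw [hskew (.inr ν)] at h2
    have h0 := hx μ ν hμν
    simp only [conn, θ]
    field_simp
    linear_combination -x ν p * h1 - x μ p * h2
  · intro μ v
    have hκ := hframe.sum_kappa_inl hU hp hQ μ v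
    have hpos : √(Q μ p) ≠ 0 := (Real.sqrt_pos.2 (hQ μ)).ne'
    rw [← Finset.add_sum_erase _ _ (Finset.mem_univ μ)] at hκ
    have hrest : ∑ ν ∈ Finset.univ.erase μ, √(Q ν p) *
          connectionForm (connectionWithTorsion nabla T) e (.inl μ) (.inr ν) p v =
        (∑ ν ∈ Finset.univ.erase μ, x μ p * Q ν p / (x μ p ^ 2 - x ν p ^ 2)) * θ (.inr μ) v
          - √(Q μ p) * ∑ ν ∈ Finset.univ.erase μ,
            x μ p * √(Q ν p) / (x μ p ^ 2 - x ν p ^ 2) * θ (.inr ν) v := by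
      rw [Finset.sum_mul, Finset.mul_sum, ← Finset.sum_sub_distrib]
      refine Finset.sum_congr rfl fun ν hν ↦ ?_
      have h1 := hmixed μ ν (Finset.ne_of_mem_erase hν).symm v
      simp only [conn] at h1
      rw [h1]
      have h2 := Real.mul_self_sqrt (hQ ν).le
      linear_combination x μ p / (x μ p ^ 2 - x ν p ^ 2) * θ (.inr μ) v * h2
    rw [hrest] at hκ
    have hdiv : ∑ a, κ a (.inl μ) / √(Q μ p) * θ a v =
        (∑ a, κ a (.inl μ) * θ a v) / √(Q μ p) := by
      rw [Finset.sum_div]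
      exact Finset.sum_congr rfl fun a _ ↦ by ring
    rw [hdiv, hκ]
    simp only [conn]
    field_simp
    ring
  · intro μ ν hμν v
    have h1 := hframe.twoForm_inl_inr hU hCKY hp hμν v
    have h2 := hframe.twoForm_inl_inr hU hCKY hp hμν.symm v
    rw [hskew (.inl ν)] at h1
    rw [hskew (.inr ν)] at h2
    have h0 := hx μ ν hμν
    simp only [conn, θ]
    field_simp
    linear_combination -x μ p * h1 - x ν p * h2
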